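/- Let $\mathcal S$ be a compact metric space, $(\Omega,\mathcal F,\mathbb P)$ a probability space, and $\ell^\infty(\mathcal S)$ the space of bounded functions $\mathcal S\to\mathbb R$ with the supremum norm. For $B\subseteq\Omega$ (not necessarily measurable) put $\mathbb P^*[B]=\inf\{\mathbb P[A]: A\supseteq B,\ A\in\mathcal F\}$ and $\mathbb P_*[B]=1-\mathbb P^*[\Omega\setminus B]$. Let $\gamma:\mathcal S\to\mathbb R$ be continuous, let $\hat\gamma_n:\Omega\to\ell^\infty(\mathcal S)$, $n\ge 1$, be arbitrary maps, and let $(\tau_n)_{n\ge1}$ be a sequence of positive reals with $\tau_n\to0$ (for instance $\tau_n=1/\sqrt n$). Let $G:\Omega\to\ell^\infty(\mathcal S)$ be a Borel measurable process all of whose sample paths are continuous, and assume the functional central limit theorem $\tau_n^{-1}(\hat\gamma_n-\gamma)\xrightarrow{d}G$ in $\ell^\infty(\mathcal S)$, i.e. $\mathbb E^*\big[f(\tau_n^{-1}(\hat\gamma_n-\gamma))\big]\to\mathbb E[f(G)]$ for every bounded continuous $f:\ell^\infty(\mathcal S)\to\mathbb R$, where $\mathbb E^*$ denotes outer expectation (the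 infimum of the expectations of integrable measurable majorants). For $q\in\mathbb R$ let $$\mathcal U=\{s\in\mathcal S:|\gamma(s)|>0\},\qquad \hat{\mathcal U}=\hat{\mathcal U}_n=\{s\in\mathcal S:\tau_n^{-1}|\hat\gamma_n(s)|>q\}.$$ Then, with the convention $\sup_{\emptyset}=-\infty$, $$(i)\quad \liminf_{n\to\infty}\mathbb P_*\big[\hat{\mathcal U}\subseteq\mathcal U\big]\ \ge\ \mathbb P\Big[\sup_{s\in\gamma^{-1}(0)}|G(s)|<q\Big],$$ $$(ii)\quad \limsup_{n\to\infty}\mathbb P^*\big[\hat{\mathcal U}\subseteq\mathcal U\big]\ \le\ \mathbb P\Big[\sup_{s\in\gamma^{-1}(0)}|G(s)|\le q\Big].$$ -/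

import Mathlib

open MeasureTheory Filter Topology
open scoped ENNReal BoundedContinuousFunction

namespace AbsValCR

/-- The space of bounded real functions on `S`, with the supremum norm. -/
abbrev Linf (S : Type*) : Type _ := lp (fun _ : S => ℝ) ∞

/-- A continuous function on a compact space, regarded as a bounded function. -/
def toLinf {S : Type*} [TopologicalSpace S] [CompactSpace S] (f : C(S, ℝ)) : Linf S :=
  ⟨fun s => f s, memℓp_infty (by
    refine ⟨‖f‖, ?_⟩
    rintro _ ⟨s, rfl⟩
    exact f.norm_coe_le_norm s)⟩

/-- Outer probability of an arbitrary subset of the sample space. -/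
noncomputable def outerProb {Ω : Type*} [MeasurableSpace Ω] (P : Measure Ω) (B : Set Ω) : ℝ≥0∞ :=
  sInf {p | ∃ A : Set Ω, B ⊆ A ∧ MeasurableSet A ∧ p = P A}

/-- Inner probability of an arbitrary subset of the sample space. -/
noncomputable def innerProb {Ω : Type*} [MeasurableSpace Ω] (P : Measure Ω) (B : Set Ω) : ℝ≥0∞ :=
  1 - outerProb P Bᶜ

/-- Outer expectation of a bounded, possibly non-measurable, function `T`: the infimum of the
expectations of the measurable integrable majorants of `T`. -/
noncomputable def outerExpect {Ω : Type*} [MeasurableSpace Ω] (P : Measure Ω) (T : Ω → ℝ) : ℝ :=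
  sInf {r | ∃ U : Ω → ℝ, Measurable U ∧ Integrable U P ∧ (∀ ω, T ω ≤ U ω) ∧ r = ∫ ω, U ω ∂P}

/-- Weak convergence in the sense of Hoffmann-Jorgensen (van der Vaart and Wellner): the maps
`X n` are arbitrary, the limit `Y` is Borel measurable, and the outer expectation of `f (X n)`
tends to the expectation of `f Y` for every bounded continuous `f`. -/
def WeaklyConverges {Ω : Type*} [MeasurableSpace Ω] (P : Measure Ω) {D : Type*}
    [TopologicalSpace D] (X : ℕ → Ω → D) (Y : Ω → D) : Prop :=
  Measurable[_, borel D] Y ∧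
    ∀ f : D →ᵇ ℝ,
      Tendsto (fun n => outerExpect P (fun ω => f (X n ω))) atTop (𝓝 (∫ ω, f (Y ω) ∂P))

/-- The set `{s | |γ s| > 0}`. -/
def signalSet {S : Type*} (γ : S → ℝ) : Set S := {s | |γ s| > 0}

/-- The region `{s | t⁻¹ * |g s| > q}` built from an estimate `g`, rate `t` and threshold `q`. -/
def confRegion {S : Type*} (t q : ℝ) (g : S → ℝ) : Set S := {s | t⁻¹ * |g s| > q}

/-- The supremum of `|g|` over `A`, in the extended reals, so that it is `-∞` if `A` is empty. -/
noncomputable def supAbs {S : Type*} (A : Set S) (g : S → ℝ) : EReal :=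
  ⨆ s ∈ A, ((|g s| : ℝ) : EReal)

end AbsValCR

namespace AbsValCR

/-! Inclusion can fail only at zeros of `γ`, where `γhat` is its own estimation error. So it holds
exactly when the rescaled error lies in the set of `x` with `|x| ≤ q` on the zero set. This set is
closed in `Linf S`, and its strict version is open. Bound (ii) is the closed-set portmanteau
inequality; bound (i) is the same inequality for the complement of the open set, since inner
probability is defined through complements. The portmanteau inequality comes from Markov's
inequality applied to continuous majorants of the indicator of `C`. -/

/-- Markov's inequality for outer probabilities and outer expectations. -/
theorem outerProb_le_ofReal_outerExpect {Ω : Type*} [MeasurableSpace Ω] (P : Measure Ω)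
    [IsFiniteMeasure P] (T : Ω → ℝ) (hT0 : ∀ ω, 0 ≤ T ω) {M : ℝ} (hTM : ∀ ω, T ω ≤ M)
    (B : Set Ω) (hB : ∀ ω ∈ B, 1 ≤ T ω) :
    outerProb P B ≤ ENNReal.ofReal (outerExpect P T) := by
  have key : ∀ U : Ω → ℝ, Measurable U → Integrable U P → (∀ ω, T ω ≤ U ω) →
      outerProb P B ≤ ENNReal.ofReal (∫ ω, U ω ∂P) := by
    intro U hU hUi hTU
    have hU0 : ∀ ω, 0 ≤ U ω := fun ω => (hT0 ω).trans (hTU ω)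
    calc outerProb P B ≤ P {ω | 1 ≤ ENNReal.ofReal (U ω)} :=
          sInf_le ⟨_, fun ω hω => ENNReal.one_le_ofReal.2 ((hB ω hω).trans (hTU ω)),
            measurableSet_le measurable_const hU.ennreal_ofReal, rfl⟩
      _ ≤ ∫⁻ ω, ENNReal.ofReal (U ω) ∂P := by
          simpa using mul_meas_ge_le_lintegral (μ := P) hU.ennreal_ofReal 1
      _ = ENNReal.ofReal (∫ ω, U ω ∂P) :=
          (ofReal_integral_eq_lintegral_ofReal hUi (ae_of_all _ hU0)).symm
  have hfin : outerProb P B ≠ ∞ :=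
    ((key _ measurable_const (integrable_const M) hTM).trans_lt ENNReal.ofReal_lt_top).ne
  rw [ENNReal.le_ofReal_iff_toReal_le hfin]
  -- The constant majorant `M` makes the set of expectations nonempty, so its real `sInf` is not the
  -- default value 0.
  · refine le_csInf ⟨_, fun _ => M, measurable_const, integrable_const M, hTM, rfl⟩ ?_
    rintro _ ⟨U, hU, hUi, hTU, rfl⟩
    exact ENNReal.toReal_le_of_le_ofReal
      (integral_nonneg fun ω => (hT0 ω).trans (hTU ω)) (key U hU hUi hTU)
  · refine Real.sInf_nonneg ?_
    rintro _ ⟨U, -, -, hTU, rfl⟩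
    exact integral_nonneg fun ω => (hT0 ω).trans (hTU ω)

theorem outerProb_mono {Ω : Type*} [MeasurableSpace Ω] (P : Measure Ω) {A B : Set Ω}
    (h : A ⊆ B) : outerProb P A ≤ outerProb P B :=
  sInf_le_sInf fun _ ⟨C, hBC, hC, hp⟩ => ⟨C, h.trans hBC, hC, hp⟩

/-- The closed-set half of the portmanteau theorem for weak convergence in the sense of
Hoffmann-Jorgensen. -/
theorem WeaklyConverges.limsup_outerProb_le {Ω : Type*} [MeasurableSpace Ω] {P : Measure Ω}
    [IsProbabilityMeasure P] {D : Type*} [PseudoEMetricSpace D] {X : ℕ → Ω → D} {Y : Ω → D}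
    (h : WeaklyConverges P X Y) {C : Set D} (hC : IsClosed C) :
    limsup (fun n => outerProb P {ω | X n ω ∈ C}) atTop ≤ P {ω | Y ω ∈ C} := by
  borelize D
  obtain ⟨hY, hlim⟩ := h
  have hδ : ∀ k : ℕ, (0 : ℝ) < 1 / ((k : ℝ) + 1) := fun k => Nat.one_div_pos_of_nat
  have hmap := tendsto_lintegral_thickenedIndicator_of_isClosed (P.map Y) hC hδ
    tendsto_one_div_add_atTop_nhds_zero_nat
  rw [Measure.map_apply hY hC.measurableSet] at hmap
  -- It suffices to bound the limsup by the expectation of each thickened indicator: these tend to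
  -- the mass of `C`.
  refine ge_of_tendsto' hmap fun k => ?_
  let g := thickenedIndicator (hδ k) C
  have hg1 : ∀ x, (g x : ℝ) ≤ 1 := fun x => by
    exact NNReal.coe_le_one.2 (thickenedIndicator_le_one (hδ k) C x)
  let f : D →ᵇ ℝ := BoundedContinuousFunction.ofNormedAddCommGroup (fun x => (g x : ℝ))
    (NNReal.continuous_coe.comp g.continuous) 1 fun x => by simpa using hg1 x
  have hf : ENNReal.ofReal (∫ ω, f (Y ω) ∂P) = ∫⁻ x, (g x : ℝ≥0∞) ∂(P.map Y) := by
    rw [lintegral_map (by fun_prop) hY, ofReal_integral_eq_lintegral_ofReal]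
    · exact lintegral_congr fun ω => ENNReal.ofReal_coe_nnreal
    · exact Integrable.of_bound (f.continuous.measurable.comp hY).aestronglyMeasurable 1
        (ae_of_all _ fun ω => by simpa [f] using hg1 (Y ω))
    · exact ae_of_all _ fun ω => (g (Y ω)).2
  have hl := (ENNReal.continuous_ofReal.tendsto _).comp (hlim f)
  rw [hf] at hl
  rw [← hl.limsup_eq]
  refine limsup_le_limsup (Eventually.of_forall fun n => ?_)
  refine outerProb_le_ofReal_outerExpect P _ (fun ω => (g (X n ω)).2) (fun ω => hg1 (X n ω)) _
    fun ω hω => ?_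
  have h1 : g (X n ω) = 1 := thickenedIndicator_one (hδ k) C hω
  simp [h1]

theorem supAbs_le_coe_iff {S : Type*} {A : Set S} {g : S → ℝ} {q : ℝ} :
    supAbs A g ≤ (q : EReal) ↔ ∀ s ∈ A, |g s| ≤ q := by
  simp [supAbs, iSup_le_iff]

theorem isClosed_setOf_supAbs_le {S : Type*} (A : Set S) (q : ℝ) :
    IsClosed {x : Linf S | supAbs A (fun s => x s) ≤ (q : EReal)} := by
  simp only [supAbs_le_coe_iff, Set.ofPred_forall]
  refine isClosed_biInter fun s _ => isClosed_le ?_ continuous_const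
  have h : LipschitzWith 1 fun x : Linf S => x s := LipschitzWith.of_dist_le_mul fun x y => by
    simpa [dist_eq_norm] using lp.norm_apply_le_norm ENNReal.top_ne_zero (x - y) s
  exact h.continuous.abs

/-- Strictness of the supremum, unlike pointwise strictness, leaves a gap `q - r` uniform over `A`;
moving by less than half of it keeps the supremum below `q`. -/
theorem isOpen_setOf_supAbs_lt {S : Type*} (A : Set S) (q : ℝ) :
    IsOpen {x : Linf S | supAbs A (fun s => x s) < (q : EReal)} := by
  rw [Metric.isOpen_iff]
  intro x hx
  obtain ⟨r, hxr, hrq⟩ := EReal.lt_iff_exists_real_btwn.1 hx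
  have hrq' : r < q := EReal.coe_lt_coe_iff.1 hrq
  refine ⟨(q - r) / 2, by linarith, fun y hy => ?_⟩
  have hle : supAbs A (fun s => y s) ≤ ((r + (q - r) / 2 : ℝ) : EReal) := by
    refine supAbs_le_coe_iff.2 fun s hs => ?_
    have h1 := supAbs_le_coe_iff.1 hxr.le s hs
    have h2 : |y s - x s| ≤ ‖y - x‖ := by
      simpa using lp.norm_apply_le_norm ENNReal.top_ne_zero (y - x) s
    rw [Metric.mem_ball, dist_eq_norm] at hy
    have h3 := abs_sub_abs_le_abs_sub (y s) (x s)
    linarith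
  exact hle.trans_lt (EReal.coe_lt_coe_iff.2 (by linarith))

/-- The estimated region is contained in the signal set exactly when the rescaled error is at
most `q` in absolute value on the zero set. -/
theorem confRegion_subset_signalSet_iff {S : Type*} [TopologicalSpace S] [CompactSpace S]
    (γ : C(S, ℝ)) (g : Linf S) {t : ℝ} (ht : 0 < t) (q : ℝ) :
    (confRegion t q (fun s => g s) ⊆ signalSet fun s => γ s) ↔
      supAbs (γ ⁻¹' {0}) (fun s => (t⁻¹ • (g - toLinf γ)) s) ≤ (q : EReal) := by
  rw [supAbs_le_coe_iff]
  have hval : ∀ s, γ s = 0 → |(t⁻¹ • (g - toLinf γ)) s| = t⁻¹ * |g s| := fun s hs => by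
    have h : (t⁻¹ • (g - toLinf γ)) s = t⁻¹ * (g s - γ s) := rfl
    rw [h, hs, sub_zero, abs_mul, abs_of_pos (inv_pos.2 ht)]
  constructor
  · intro h s hs
    rw [hval s hs]
    by_contra! hq
    have := h hq
    simp_all [signalSet]
  · intro h s hs
    by_contra hn
    have h0 : γ s = 0 := by simpa [signalSet] using hn
    have := h s h0
    rw [hval s h0] at this
    exact absurd hs this.not_gt

end AbsValCR

theorem mainTheorem7 {S : Type*} [MetricSpace S] [CompactSpace S]
    {Ω : Type*} [MeasurableSpace Ω] (P : Measure Ω) [IsProbabilityMeasure P]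
    (γ : C(S, ℝ)) (γhat : ℕ → Ω → AbsValCR.Linf S) (G : Ω → AbsValCR.Linf S)
    (τ : ℕ → ℝ) (hτpos : ∀ n, 1 ≤ n → 0 < τ n) (hτ : Tendsto τ atTop (𝓝 0))
    (hGcont : ∀ ω, Continuous fun s => G ω s)
    (hfclt : AbsValCR.WeaklyConverges P
      (fun n ω => (τ n)⁻¹ • (γhat n ω - AbsValCR.toLinf γ)) G)
    (q : ℝ) :
    P {ω | AbsValCR.supAbs (γ ⁻¹' {0}) (fun s => G ω s) < (q : EReal)} ≤
        liminf (fun n => AbsValCR.innerProb P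
          {ω | AbsValCR.confRegion (τ n) q (fun s => γhat n ω s) ⊆
            AbsValCR.signalSet fun s => γ s}) atTop ∧
      limsup (fun n => AbsValCR.outerProb P
          {ω | AbsValCR.confRegion (τ n) q (fun s => γhat n ω s) ⊆
            AbsValCR.signalSet fun s => γ s}) atTop ≤
        P {ω | AbsValCR.supAbs (γ ⁻¹' {0}) (fun s => G ω s) ≤ (q : EReal)} := by
  set A := γ ⁻¹' {0}
  have hiff : ∀ᶠ n in atTop, ∀ ω,
      (AbsValCR.confRegion (τ n) q (fun s => γhat n ω s) ⊆ AbsValCR.signalSet fun s => γ s) ↔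
        AbsValCR.supAbs A (fun s => ((τ n)⁻¹ • (γhat n ω - AbsValCR.toLinf γ)) s) ≤ (q : EReal) :=
    (eventually_ge_atTop 1).mono fun n hn ω =>
      AbsValCR.confRegion_subset_signalSet_iff γ (γhat n ω) (hτpos n hn) q
  constructor
  · have hO := AbsValCR.isOpen_setOf_supAbs_lt A q
    have hmeas : MeasurableSet {ω | AbsValCR.supAbs A (fun s => G ω s) < (q : EReal)} := by
      borelize (AbsValCR.Linf S)
      exact hfclt.1 hO.measurableSet
    have hlim := hfclt.limsup_outerProb_le hO.isClosed_compl
    have hcompl : P {ω | G ω ∈ {x : AbsValCR.Linf S |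
        AbsValCR.supAbs A (fun s => x s) < (q : EReal)}ᶜ} =
        1 - P {ω | AbsValCR.supAbs A (fun s => G ω s) < (q : EReal)} :=
      prob_compl_eq_one_sub hmeas
    rw [hcompl] at hlim
    unfold AbsValCR.innerProb
    rw [ENNReal.liminf_const_sub _ _ ENNReal.one_ne_top]
    calc P {ω | AbsValCR.supAbs A (fun s => G ω s) < (q : EReal)}
        = 1 - (1 - P {ω | AbsValCR.supAbs A (fun s => G ω s) < (q : EReal)}) :=
          (ENNReal.sub_sub_cancel ENNReal.one_ne_top prob_le_one).symm
      _ ≤ _ := tsub_le_tsub_left (le_trans (limsup_le_limsup ?_) hlim) 1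
    -- If inclusion fails, the error's supremum exceeds `q`, so the error lies in the closed
    -- complement of the open set.
    filter_upwards [hiff] with n hn
    refine AbsValCR.outerProb_mono P fun ω hω hlt => hω ?_
    exact (hn ω).2 (le_of_lt hlt)
  · refine le_trans (limsup_le_limsup ?_)
      (hfclt.limsup_outerProb_le (AbsValCR.isClosed_setOf_supAbs_le A q))
    filter_upwards [hiff] with n hn
    exact AbsValCR.outerProb_mono P fun ω hω => (hn ω).1 hω
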